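/- Let $X\sim\mathcal N(0,\Sigma_X)$ be a Gaussian random vector in $\mathbb R^L$ with $\Sigma_X\succ 0$, and let $\Sigma_X=\Theta^T\Lambda_X\Theta$ with $\Theta$ orthogonal and $\Lambda_X=\mathrm{diag}(\lambda_1,\dots,\lambda_L)$. For $D,P\ge 0$ let $$R(D,P)=\inf I(X;\hat X),$$ where the infimum is over all conditional distributions $P_{\hat X|X}$ of an $\mathbb R^L$-valued reconstruction $\hat X$ such that $\mathbb E\|X-\hat X\|^2\le D$ and $W_2^2(P_X,P_{\hat X})\le P$. Here $I$ is the mutual information in nats, $W_2^2(P_X,P_{\hat X})=\inf\mathbb E\|U-V\|^2$ over all joint distributions of $(U,V)$ with $U\sim P_X$ and $V\sim P_{\hat X}$, and the infimum of the empty set is $+\infty$. Then $R(D,P)$ is the optimal value of the program $$\begin{aligned}\min_{\{\hat\lambda_\ell,\gamma_\ell\}_{\ell=1}^L}\quad&\frac12\sum_{\ell=1}^L\log\frac{\lambda_\ell}{\gamma_\ell}\\ \text{s.t.}\quad&0<\gamma_\ell\le\lambda_\ell,\qquad 0\le\hat\lambda_\ell\qquad(\ell=1,\dots,L),\\&\sum_{\ell=1}^L\Bigl(\lambda_\ell-2\sqrt{\hat\lambda_\ell(\lambda_\ell-\gamma_\ell)}+\hat\lambda_\ell\Bigr)\le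 D,\\&\sum_{\ell=1}^L\bigl(\sqrt{\lambda_\ell}-\sqrt{\hat\lambda_\ell}\bigr)^2\le P.\end{aligned}$$ If $D>0$, the program is feasible and its minimum is attained. (If $D=0$ and $L\ge 1$, the program has no feasible point and both sides equal $+\infty$.) -/

import Mathlib

namespace RDP

open MeasureTheory ProbabilityTheory
open scoped ENNReal

noncomputable section

/-- Mutual information `I(X; X̂)` (in nats) of a pair whose joint law is `π`: the Kullback-Leibler
divergence of the joint law from the product of its marginals. -/
def mutualInfo {α β : Type*} [MeasurableSpace α] [MeasurableSpace β]
    (π : Measure (α × β)) : ℝ≥0∞ :=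
  InformationTheory.klDiv π ((π.map Prod.fst).prod (π.map Prod.snd))

/-- `𝔼[‖X - X̂‖²]` for a pair `(X, X̂)` whose joint law is `π`. -/
def expSqDist {L : ℕ}
    (π : Measure (EuclideanSpace ℝ (Fin L) × EuclideanSpace ℝ (Fin L))) : ℝ≥0∞ :=
  ∫⁻ p, ‖p.1 - p.2‖ₑ ^ 2 ∂π

/-- The squared Wasserstein-2 distance: the infimum of `𝔼[‖U - V‖²]` over all joint laws of
`(U, V)` with marginals `μ` and `ν`. -/
def wassersteinTwoSq {L : ℕ} (μ ν : Measure (EuclideanSpace ℝ (Fin L))) : ℝ≥0∞ :=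
  ⨅ (π : Measure (EuclideanSpace ℝ (Fin L) × EuclideanSpace ℝ (Fin L)))
    (_ : π.map Prod.fst = μ ∧ π.map Prod.snd = ν), expSqDist π

/-- The admissible conditional laws of the reconstruction given the source (Markov kernels `κ`),
for source law `μ`, perception metric `φ`, distortion level `D` and perception level `P`. The joint
law of source and reconstruction is `μ.compProd κ` and the law of the reconstruction is its second
marginal. -/
def admissible {L : ℕ}
    (φ : Measure (EuclideanSpace ℝ (Fin L)) → Measure (EuclideanSpace ℝ (Fin L)) → ℝ≥0∞)
    (μ : Measure (EuclideanSpace ℝ (Fin L))) (D P : ℝ) :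
    Set (Kernel (EuclideanSpace ℝ (Fin L)) (EuclideanSpace ℝ (Fin L))) :=
  {κ | IsMarkovKernel κ ∧
    expSqDist (μ.compProd κ) ≤ ENNReal.ofReal D ∧
    φ μ ((μ.compProd κ).map Prod.snd) ≤ ENNReal.ofReal P}

/-- The (information) rate-distortion-perception function `R(D, P)` of a source with law `μ`, for
the perception metric `φ` and levels `D, P ≥ 0`; it is `∞` if no conditional law is admissible. -/
def rate {L : ℕ}
    (φ : Measure (EuclideanSpace ℝ (Fin L)) → Measure (EuclideanSpace ℝ (Fin L)) → ℝ≥0∞)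
    (μ : Measure (EuclideanSpace ℝ (Fin L))) (D P : ℝ) : ℝ≥0∞ :=
  ⨅ κ ∈ admissible φ μ D P, mutualInfo (μ.compProd κ)

/-- Distortion of one component, as a function of `γ` and `lamHat`. -/
def compDistortion (lam γ lamHat : ℝ) : ℝ :=
  lam - 2 * √(lamHat * (lam - γ)) + lamHat

/-- Wasserstein-2 perception loss of one component, as a function of `lamHat`. -/
def compPerception (lam lamHat : ℝ) : ℝ := (√lam - √lamHat) ^ 2

/-- Objective of the optimization program at the point `q = (γ, lamHat)`. -/
def objective {L : ℕ} (lam : Fin L → ℝ) (q : (Fin L → ℝ) × (Fin L → ℝ)) : ℝ :=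
  (1 / 2 : ℝ) * ∑ l, Real.log (lam l / q.1 l)

/-- Feasible points `q = (γ, lamHat)` of the optimization program. -/
def feasible {L : ℕ} (lam : Fin L → ℝ) (D P : ℝ) : Set ((Fin L → ℝ) × (Fin L → ℝ)) :=
  {q | (∀ l, 0 < q.1 l ∧ q.1 l ≤ lam l) ∧
    (∀ l, 0 ≤ q.2 l) ∧
    ∑ l, compDistortion (lam l) (q.1 l) (q.2 l) ≤ D ∧
    ∑ l, compPerception (lam l) (q.2 l) ≤ P}

end

end RDP

/-! The isometry `ofRotatedCoords` turns the source into independent components with variances `lam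
l`. Distances are unchanged and data processing keeps mutual information from increasing in either
direction, so both inequalities are proved in coordinates.

Converse: let `d l` be the second moments of the reconstruction and `c l` its correlations with the
source. The best linear estimate of component `l` has error `γ l = lam l - c l ^ 2 / d l`.
Donsker-Varadhan, tested with the log-density of `N(b y, γ)` relative to `N(0, lam)`, bounds mutual
information below by the objective at `(γ, d)` (`ofReal_sum_log_le_mutualInfo`), with no assumption
on the law of the reconstruction. By Cauchy-Schwarz the same point meets both constraints
(`iInf_objective_le_mutualInfo`); a vanishing error forces infinite information.

Achievability: the backward channel `X = b Y + N` with Gaussian `Y`, `N` makes that test function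
the true log-density, and scaling each coordinate couples the two marginals at the required cost
(`exists_joint_of_mem_feasible`, `exists_coupling_coordSqDist_eq`).

The minimum is attained because sublevel sets of the objective lie in a compact set of feasible
points. -/

open MeasureTheory ProbabilityTheory
open scoped ENNReal NNReal

namespace RDP

/-! ### Divergence bounds and data processing. -/

section DivergenceTools

variable {α : Type*} [MeasurableSpace α]

/-- The Donsker-Varadhan lower bound for a test function normalised by `∫ exp f = 1`. -/
lemma ofReal_integral_le_klDiv {π ρ : Measure α} [IsProbabilityMeasure π] [IsProbabilityMeasure ρ]
    {f : α → ℝ} (hfm : Measurable f) (hf : Integrable f π)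
    (hexp : ∫⁻ x, ENNReal.ofReal (Real.exp (f x)) ∂ρ = 1) :
    ENNReal.ofReal (∫ x, f x ∂π) ≤ InformationTheory.klDiv π ρ := by
  by_cases h : π ≪ ρ ∧ Integrable (llr π ρ) π
  swap
  · have : InformationTheory.klDiv π ρ = ∞ := by
      rw [InformationTheory.klDiv_eq_top_iff]; tauto
    simp [this]
  obtain ⟨hac, hint⟩ := h
  have hexpi : Integrable (fun x ↦ Real.exp (f x)) ρ := by
    refine ⟨by fun_prop, ?_⟩
    rw [hasFiniteIntegral_iff_ofReal (ae_of_all _ fun _ ↦ (Real.exp_pos _).le), hexp]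
    exact ENNReal.one_lt_top
  have hone : ∫ x, Real.exp (f x) ∂ρ = 1 := by
    rw [integral_eq_lintegral_of_nonneg_ae (ae_of_all _ fun _ ↦ (Real.exp_pos _).le) (by fun_prop),
      hexp, ENNReal.toReal_one]
  have := isProbabilityMeasure_tilted hexpi
  -- Gibbs' inequality for `π` against `ρ` tilted by `f`. Tilting subtracts `f` from the
  -- log-likelihood ratio, up to the log of the normaliser, which is zero here.
  have hnonneg := InformationTheory.integral_llr_add_sub_measure_univ_nonneg
    (hac.trans (absolutelyContinuous_tilted hexpi))
    (integrable_llr_tilted_right hac hf hint hexpi)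
  rw [integral_llr_tilted_right hac hf hexpi hint, hone] at hnonneg
  rw [InformationTheory.klDiv_of_ac_of_integrable hac hint]
  apply ENNReal.ofReal_le_ofReal
  simp only [Real.log_one, probReal_univ] at hnonneg ⊢
  linarith

/-- The equality case of Donsker-Varadhan: the test function is the log-likelihood ratio itself. -/
lemma klDiv_withDensity_ofReal_exp {ρ : Measure α} [IsProbabilityMeasure ρ]
    {f : α → ℝ} (hfm : Measurable f)
    [IsProbabilityMeasure (ρ.withDensity fun x ↦ ENNReal.ofReal (Real.exp (f x)))]
    (hf : Integrable f (ρ.withDensity fun x ↦ ENNReal.ofReal (Real.exp (f x)))) :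
    InformationTheory.klDiv (ρ.withDensity fun x ↦ ENNReal.ofReal (Real.exp (f x))) ρ =
      ENNReal.ofReal (∫ x, f x ∂(ρ.withDensity fun x ↦ ENNReal.ofReal (Real.exp (f x)))) := by
  set π := ρ.withDensity fun x ↦ ENNReal.ofReal (Real.exp (f x)) with hπ
  have hac : π ≪ ρ := withDensity_absolutelyContinuous _ _
  have hllr : llr π ρ =ᵐ[π] f := by
    filter_upwards [hac.ae_le (Measure.rnDeriv_withDensity ρ
      (f := fun x ↦ ENNReal.ofReal (Real.exp (f x))) (by fun_prop))] with x hx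
    rw [llr, hπ, hx, ENNReal.toReal_ofReal (Real.exp_pos _).le, Real.log_exp]
  rw [InformationTheory.klDiv_of_ac_of_integrable hac (hf.congr hllr.symm),
    integral_congr_ae hllr]
  simp

end DivergenceTools

lemma map_prodMap_fst {α β α' β' : Type*} [MeasurableSpace α] [MeasurableSpace β]
    [MeasurableSpace α'] [MeasurableSpace β'] (π : Measure (α × β)) {f : α → α'} {g : β → β'}
    (hf : Measurable f) (hg : Measurable g) :
    (π.map (Prod.map f g)).map Prod.fst = (π.map Prod.fst).map f := by
  rw [Measure.map_map (by fun_prop) (by fun_prop), Measure.map_map (by fun_prop) (by fun_prop)]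
  rfl

lemma map_prodMap_snd {α β α' β' : Type*} [MeasurableSpace α] [MeasurableSpace β]
    [MeasurableSpace α'] [MeasurableSpace β'] (π : Measure (α × β)) {f : α → α'} {g : β → β'}
    (hf : Measurable f) (hg : Measurable g) :
    (π.map (Prod.map f g)).map Prod.snd = (π.map Prod.snd).map g := by
  rw [Measure.map_map (by fun_prop) (by fun_prop), Measure.map_map (by fun_prop) (by fun_prop)]
  rfl

/-- Data processing: the product of the marginals is carried to the product of the new marginals by
the same map. -/
lemma mutualInfo_map_prodMap_le {α β α' β' : Type*} [MeasurableSpace α] [MeasurableSpace β]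
    [MeasurableSpace α'] [MeasurableSpace β'] (π : Measure (α × β)) [IsFiniteMeasure π]
    {f : α → α'} {g : β → β'} (hf : Measurable f) (hg : Measurable g) :
    mutualInfo (π.map (Prod.map f g)) ≤ mutualInfo π := by
  rw [mutualInfo, map_prodMap_fst π hf hg, map_prodMap_snd π hf hg,
    Measure.map_prod_map _ _ hf hg]
  exact InformationTheory.klDiv_map_le _ _ (hf.prodMap hg)

/-! ### Densities of finite products. -/

section ProductMeasures

variable {ι : Type*} [Fintype ι] {X : ι → Type*} [∀ i, MeasurableSpace (X i)]

lemma lintegral_pi_prod (μ : ∀ i, Measure (X i)) [∀ i, IsProbabilityMeasure (μ i)]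
    {g : ∀ i, X i → ℝ≥0∞} (hg : ∀ i, Measurable (g i)) :
    ∫⁻ x, ∏ i, g i (x i) ∂(Measure.pi μ) = ∏ i, ∫⁻ x, g i x ∂(μ i) := by
  have hind := iIndepFun_pi (μ := μ) (X := g) (fun i ↦ (hg i).aemeasurable)
  rw [lintegral_prod_eq_prod_lintegral_of_indepFun Finset.univ _ hind
    (fun i ↦ (hg i).comp (measurable_pi_apply i))]
  refine Finset.prod_congr rfl fun i _ ↦ ?_
  rw [← (measurePreserving_eval μ i).map_eq, lintegral_map (hg i) (measurable_pi_apply i)]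

lemma pi_withDensity (μ : ∀ i, Measure (X i)) [∀ i, IsProbabilityMeasure (μ i)]
    {g : ∀ i, X i → ℝ≥0∞} (hg : ∀ i, Measurable (g i))
    [∀ i, SigmaFinite ((μ i).withDensity (g i))] :
    Measure.pi (fun i ↦ (μ i).withDensity (g i)) =
      (Measure.pi μ).withDensity fun x ↦ ∏ i, g i (x i) := by
  refine Measure.pi_eq fun s hs ↦ ?_
  rw [withDensity_apply _ (MeasurableSet.univ_pi hs),
    ← lintegral_indicator (MeasurableSet.univ_pi hs)]
  have : (Set.univ.pi s).indicator (fun x ↦ ∏ i, g i (x i)) =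
      fun x ↦ ∏ i, (s i).indicator (g i) (x i) := by
    classical
    ext x
    by_cases hx : x ∈ Set.univ.pi s
    · rw [Set.indicator_of_mem hx]
      exact Finset.prod_congr rfl fun i _ ↦ (Set.indicator_of_mem (hx i trivial) _).symm
    · rw [Set.indicator_of_notMem hx]
      simp only [Set.mem_pi, not_forall] at hx
      obtain ⟨i, -, hi⟩ := hx
      exact (Finset.prod_eq_zero (Finset.mem_univ i) (Set.indicator_of_notMem hi _)).symm
  rw [this, lintegral_pi_prod μ fun i ↦ (hg i).indicator (hs i)]
  refine Finset.prod_congr rfl fun i _ ↦ ?_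
  rw [lintegral_indicator (hs i), withDensity_apply _ (hs i)]

end ProductMeasures

/-! ### One-dimensional Gaussian densities and the backward channel. -/

/-- The logarithm of the density of `N(m, γ)` with respect to `N(0, lam)`. -/
noncomputable def gaussianLogRatio (lam γ m x : ℝ) : ℝ :=
  (1 / 2 : ℝ) * Real.log (lam / γ) - (x - m) ^ 2 / (2 * γ) + x ^ 2 / (2 * lam)

@[fun_prop]
lemma measurable_gaussianLogRatio {α : Type*} [MeasurableSpace α] (lam γ : ℝ) {m x : α → ℝ}
    (hm : Measurable m) (hx : Measurable x) :
    Measurable fun a ↦ gaussianLogRatio lam γ (m a) (x a) := by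
  unfold gaussianLogRatio
  fun_prop

lemma gaussianReal_eq_withDensity {lam γ : ℝ} (hl : 0 < lam) (hγ : 0 < γ) (m : ℝ) :
    gaussianReal m γ.toNNReal = (gaussianReal 0 lam.toNNReal).withDensity
      fun x ↦ ENNReal.ofReal (Real.exp (gaussianLogRatio lam γ m x)) := by
  rw [gaussianReal_of_var_ne_zero _ (by simpa using hγ),
    gaussianReal_of_var_ne_zero _ (by simpa using hl),
    ← withDensity_mul _ (by fun_prop) (by fun_prop)]
  congr 1
  ext x
  rw [Pi.mul_apply, gaussianPDF, gaussianPDF,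
    ← ENNReal.ofReal_mul (gaussianPDFReal_nonneg _ _ _)]
  congr 1
  have hs : Real.exp ((1 / 2 : ℝ) * Real.log (lam / γ)) = √lam / √γ := by
    rw [← Real.sqrt_div hl.le, Real.sqrt_eq_rpow, Real.rpow_def_of_pos (by positivity), mul_comm]
  have hl' : √lam ≠ 0 := (Real.sqrt_pos.2 hl).ne'
  have hγ' : √γ ≠ 0 := (Real.sqrt_pos.2 hγ).ne'
  have h2 : √(2 * Real.pi) ≠ 0 := (Real.sqrt_pos.2 (by positivity)).ne'
  rw [gaussianPDFReal, gaussianPDFReal, gaussianLogRatio, Real.coe_toNNReal _ hl.le,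
    Real.coe_toNNReal _ hγ.le, Real.exp_add, sub_eq_add_neg (1 / 2 * Real.log _), Real.exp_add, hs,
    Real.sqrt_mul (by positivity) γ, Real.sqrt_mul (by positivity) lam]
  have he : Real.exp (-(x - 0) ^ 2 / (2 * lam)) * Real.exp (x ^ 2 / (2 * lam)) = 1 := by
    rw [← Real.exp_add, ← Real.exp_zero]
    congr 1
    ring
  calc (√(2 * Real.pi) * √γ)⁻¹ * Real.exp (-(x - m) ^ 2 / (2 * γ))
      = (√(2 * Real.pi) * √γ)⁻¹ * Real.exp (-(x - m) ^ 2 / (2 * γ)) * 1 := by ring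
    _ = _ := by
      rw [← he, neg_div (2 * γ)]
      field_simp

/-- The normalisation needed for Donsker-Varadhan; it holds for every mean `m`, hence for each value
of the reconstruction. -/
lemma lintegral_exp_gaussianLogRatio {lam γ : ℝ} (hl : 0 < lam) (hγ : 0 < γ) (m : ℝ) :
    ∫⁻ x, ENNReal.ofReal (Real.exp (gaussianLogRatio lam γ m x)) ∂(gaussianReal 0 lam.toNNReal)
      = 1 := by
  rw [← setLIntegral_univ, ← withDensity_apply _ MeasurableSet.univ,
    ← gaussianReal_eq_withDensity hl hγ, measure_univ]

lemma integral_sq_gaussianReal (v : ℝ≥0) : ∫ x, x ^ 2 ∂(gaussianReal 0 v) = v := by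
  have h := variance_fun_id_gaussianReal (μ := 0) (v := v)
  rw [variance_of_integral_eq_zero (by fun_prop) integral_id_gaussianReal] at h
  exact h

lemma integrable_sq_gaussianReal (v : ℝ≥0) : Integrable (fun x ↦ x ^ 2) (gaussianReal 0 v) :=
  (memLp_id_gaussianReal 2).integrable_sq

/-- The joint law of `(b Y + N, Y)` for independent centred Gaussians `Y` and `N`, of variances
`lamHat` and `γ`. -/
noncomputable def backwardLaw (b γ lamHat : ℝ) : Measure (ℝ × ℝ) :=
  ((gaussianReal 0 lamHat.toNNReal).prod (gaussianReal 0 γ.toNNReal)).map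
    fun p ↦ (b * p.1 + p.2, p.1)

instance (b γ lamHat : ℝ) : IsProbabilityMeasure (backwardLaw b γ lamHat) :=
  Measure.isProbabilityMeasure_map (by fun_prop)

/-- Given `Y = y` the first coordinate is `N(b y, γ)`. The density acts only on that coordinate, so
a degenerate `Y` (`lamHat = 0`) is allowed. -/
lemma backwardLaw_eq_withDensity (b : ℝ) {lam γ : ℝ} (lamHat : ℝ) (hl : 0 < lam) (hγ : 0 < γ) :
    backwardLaw b γ lamHat =
      ((gaussianReal 0 lam.toNNReal).prod (gaussianReal 0 lamHat.toNNReal)).withDensity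
        fun p ↦ ENNReal.ofReal (Real.exp (gaussianLogRatio lam γ (b * p.2) p.1)) := by
  refine Measure.ext_of_lintegral _ fun g hg ↦ ?_
  rw [backwardLaw, lintegral_map hg (by fun_prop), lintegral_prod _ (by fun_prop),
    lintegral_withDensity_eq_lintegral_mul _ (by fun_prop) hg, lintegral_prod_symm _ (by fun_prop)]
  refine lintegral_congr fun y ↦ ?_
  have h := gaussianReal_map_const_add (μ := 0) (v := γ.toNNReal) (b * y)
  rw [zero_add] at h
  have h2 : ∫⁻ n, g (b * y + n, y) ∂(gaussianReal 0 γ.toNNReal) =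
      ∫⁻ x, g (x, y) ∂(gaussianReal (b * y) γ.toNNReal) := by
    rw [← h, lintegral_map (by fun_prop) (by fun_prop)]
  rw [h2, gaussianReal_eq_withDensity hl hγ,
    lintegral_withDensity_eq_lintegral_mul _ (by fun_prop) (by fun_prop)]
  rfl

lemma map_snd_backwardLaw (b γ lamHat : ℝ) :
    (backwardLaw b γ lamHat).map Prod.snd = gaussianReal 0 lamHat.toNNReal := by
  rw [backwardLaw, Measure.map_map (by fun_prop) (by fun_prop)]
  exact measurePreserving_fst.map_eq

lemma map_fst_backwardLaw {b γ lamHat lam : ℝ} (hγ : 0 ≤ γ) (hlh : 0 ≤ lamHat)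
    (h : b ^ 2 * lamHat + γ = lam) :
    (backwardLaw b γ lamHat).map Prod.fst = gaussianReal 0 lam.toNNReal := by
  rw [backwardLaw, Measure.map_map (by fun_prop) (by fun_prop)]
  have : (Prod.fst ∘ fun p : ℝ × ℝ ↦ (b * p.1 + p.2, p.1)) =
      (fun p : ℝ × ℝ ↦ p.1 + p.2) ∘ Prod.map (b * ·) id := by ext; rfl
  rw [this, ← Measure.map_map (by fun_prop) (by fun_prop),
    ← Measure.map_prod_map _ _ (by fun_prop) (by fun_prop), Measure.map_id,
    gaussianReal_map_const_mul]
  have hc := gaussianReal_conv_gaussianReal (m₁ := b * 0) (m₂ := 0)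
    (v₁ := .mk (b ^ 2) (sq_nonneg _) * lamHat.toNNReal) (v₂ := γ.toNNReal)
  rw [Measure.conv] at hc
  rw [hc]
  congr 1
  · simp
  · ext
    push_cast
    rw [Real.coe_toNNReal _ hγ, Real.coe_toNNReal _ hlh,
      Real.coe_toNNReal _ (h ▸ by positivity), h]

lemma integral_comp_backwardLaw {b γ lamHat : ℝ} {g : ℝ × ℝ → ℝ} (hg : Measurable g) :
    ∫ p, g p ∂(backwardLaw b γ lamHat) = ∫ p, g (b * p.1 + p.2, p.1)
      ∂((gaussianReal 0 lamHat.toNNReal).prod (gaussianReal 0 γ.toNNReal)) := by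
  rw [backwardLaw, integral_map (by fun_prop) hg.aestronglyMeasurable]

/-- Second moments under the backward law. -/
lemma integral_sq_backwardLaw {b γ lamHat : ℝ} (hγ : 0 ≤ γ) (hlh : 0 ≤ lamHat) (s t : ℝ) :
    Integrable (fun p : ℝ × ℝ ↦ (s * p.1 + t * p.2) ^ 2) (backwardLaw b γ lamHat) ∧
    ∫ p, (s * p.1 + t * p.2) ^ 2 ∂(backwardLaw b γ lamHat) =
      (s * b + t) ^ 2 * lamHat + s ^ 2 * γ := by
  set A := gaussianReal 0 lamHat.toNNReal
  set B := gaussianReal 0 γ.toNNReal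
  have h1 : Integrable (fun p : ℝ × ℝ ↦ p.1 ^ 2) (A.prod B) :=
    (integrable_sq_gaussianReal _).comp_fst B
  have h2 : Integrable (fun p : ℝ × ℝ ↦ p.2 ^ 2) (A.prod B) :=
    (integrable_sq_gaussianReal _).comp_snd A
  have h3 : Integrable (fun p : ℝ × ℝ ↦ p.1 * p.2) (A.prod B) :=
    Integrable.mul_prod ((memLp_id_gaussianReal 1).integrable le_rfl)
      ((memLp_id_gaussianReal 1).integrable le_rfl)
  have e1 : ∫ p : ℝ × ℝ, p.1 ^ 2 ∂(A.prod B) = lamHat := by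
    rw [integral_fun_fst (fun x : ℝ ↦ x ^ 2), integral_sq_gaussianReal,
      Real.coe_toNNReal _ hlh]
    simp
  have e2 : ∫ p : ℝ × ℝ, p.2 ^ 2 ∂(A.prod B) = γ := by
    rw [integral_fun_snd (fun x : ℝ ↦ x ^ 2), integral_sq_gaussianReal,
      Real.coe_toNNReal _ hγ]
    simp
  have e3 : ∫ p : ℝ × ℝ, p.1 * p.2 ∂(A.prod B) = 0 := by
    rw [integral_prod_mul (fun x : ℝ ↦ x) (fun x : ℝ ↦ x), integral_id_gaussianReal, zero_mul]
  have hexp : (fun p : ℝ × ℝ ↦ (s * (b * p.1 + p.2) + t * p.1) ^ 2) =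
      fun p ↦ (s * b + t) ^ 2 * p.1 ^ 2 + s ^ 2 * p.2 ^ 2 + 2 * s * (s * b + t) * (p.1 * p.2) := by
    ext p; ring
  constructor
  · rw [backwardLaw, integrable_map_measure (by fun_prop) (by fun_prop)]
    simp only [Function.comp_def]
    rw [hexp]
    exact ((h1.const_mul _).add (h2.const_mul _)).add (h3.const_mul _)
  · rw [integral_comp_backwardLaw (by fun_prop)]
    simp only
    have h12 : Integrable (fun p : ℝ × ℝ ↦ (s * b + t) ^ 2 * p.1 ^ 2 + s ^ 2 * p.2 ^ 2)
        (A.prod B) := (h1.const_mul _).add (h2.const_mul _)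
    rw [hexp, integral_add h12 (h3.const_mul _),
      integral_add (h1.const_mul _) (h2.const_mul _), integral_const_mul, integral_const_mul,
      integral_const_mul, e1, e2, e3]
    ring

/-- The quadratic terms have means `-1/2` and `1/2`, since `X - b Y` has variance `γ` and `X` has
variance `lam`; only the logarithm survives. -/
lemma integral_gaussianLogRatio_backwardLaw {b γ lamHat lam : ℝ} (hl : 0 < lam) (hγ : 0 < γ)
    (hlh : 0 ≤ lamHat) (h : b ^ 2 * lamHat + γ = lam) :
    Integrable (fun p : ℝ × ℝ ↦ gaussianLogRatio lam γ (b * p.2) p.1) (backwardLaw b γ lamHat) ∧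
    ∫ p, gaussianLogRatio lam γ (b * p.2) p.1 ∂(backwardLaw b γ lamHat) =
      (1 / 2 : ℝ) * Real.log (lam / γ) := by
  obtain ⟨i1, e1⟩ := integral_sq_backwardLaw (b := b) hγ.le hlh 1 (-b)
  obtain ⟨i2, e2⟩ := integral_sq_backwardLaw (b := b) hγ.le hlh 1 0
  have hfun : (fun p : ℝ × ℝ ↦ gaussianLogRatio lam γ (b * p.2) p.1) = fun p ↦
      (1 / 2 : ℝ) * Real.log (lam / γ) - (2 * γ)⁻¹ * (1 * p.1 + -b * p.2) ^ 2 +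
        (2 * lam)⁻¹ * (1 * p.1 + 0 * p.2) ^ 2 := by
    ext p
    rw [gaussianLogRatio]
    ring
  rw [hfun]
  have i3 : Integrable (fun p : ℝ × ℝ ↦ (1 / 2 : ℝ) * Real.log (lam / γ) -
      (2 * γ)⁻¹ * (1 * p.1 + -b * p.2) ^ 2) (backwardLaw b γ lamHat) :=
    (integrable_const _).sub (i1.const_mul _)
  refine ⟨i3.add (i2.const_mul _), ?_⟩
  rw [integral_add i3 (i2.const_mul _), integral_sub (integrable_const _) (i1.const_mul _),
    integral_const_mul _ (fun p : ℝ × ℝ ↦ (1 * p.1 + -b * p.2) ^ 2),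
    integral_const_mul _ (fun p : ℝ × ℝ ↦ (1 * p.1 + 0 * p.2) ^ 2), e1, e2]
  simp only [integral_const, probReal_univ, smul_eq_mul]
  have : (1 * b + 0) ^ 2 * lamHat + 1 ^ 2 * γ = lam := by rw [← h]; ring
  rw [this]
  field_simp
  ring

/-! ### Second-moment inequalities. -/

section SecondMoments

variable {Ω : Type*} [MeasurableSpace Ω] {P : Measure Ω} {X Y : Ω → ℝ}

lemma integral_sq_linearCombination (hX : MemLp X 2 P) (hY : MemLp Y 2 P) (s t : ℝ) :
    ∫ ω, (s * X ω + t * Y ω) ^ 2 ∂P =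
      s ^ 2 * ∫ ω, X ω ^ 2 ∂P + 2 * s * t * ∫ ω, X ω * Y ω ∂P + t ^ 2 * ∫ ω, Y ω ^ 2 ∂P := by
  have h1 := hX.integrable_sq.const_mul (s ^ 2)
  have h2 : Integrable (fun ω ↦ 2 * s * t * (X ω * Y ω)) P :=
    (hX.integrable_mul hY).const_mul (2 * s * t)
  have h3 := hY.integrable_sq.const_mul (t ^ 2)
  have h12 : Integrable (fun ω ↦ s ^ 2 * X ω ^ 2 + 2 * s * t * (X ω * Y ω)) P := h1.add h2
  have hexp : (fun ω ↦ (s * X ω + t * Y ω) ^ 2) =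
      fun ω ↦ s ^ 2 * X ω ^ 2 + 2 * s * t * (X ω * Y ω) + t ^ 2 * Y ω ^ 2 := by
    ext ω; ring
  rw [hexp, integral_add h12 h3, integral_add h1 h2, integral_const_mul, integral_const_mul,
    integral_const_mul]

/-- Cauchy-Schwarz, from the discriminant of the nonnegative quadratic `s ↦ ∫ (s X + Y) ^ 2`. -/
lemma sq_integral_mul_le (hX : MemLp X 2 P) (hY : MemLp Y 2 P) :
    (∫ ω, X ω * Y ω ∂P) ^ 2 ≤ (∫ ω, X ω ^ 2 ∂P) * ∫ ω, Y ω ^ 2 ∂P := by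
  have h : ∀ s : ℝ, 0 ≤ (∫ ω, X ω ^ 2 ∂P) * (s * s) + (2 * ∫ ω, X ω * Y ω ∂P) * s +
      ∫ ω, Y ω ^ 2 ∂P := fun s ↦ by
    have h1 := integral_sq_linearCombination hX hY s 1
    have h2 : 0 ≤ ∫ ω, (s * X ω + 1 * Y ω) ^ 2 ∂P := integral_nonneg fun ω ↦ sq_nonneg _
    rw [h1] at h2
    linarith
  have := discrim_le_zero h
  rw [discrim] at this
  linarith

lemma integral_sub_sq (hX : MemLp X 2 P) (hY : MemLp Y 2 P) :
    ∫ ω, (X ω - Y ω) ^ 2 ∂P =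
      ∫ ω, X ω ^ 2 ∂P - 2 * ∫ ω, X ω * Y ω ∂P + ∫ ω, Y ω ^ 2 ∂P := by
  have h := integral_sq_linearCombination hX hY 1 (-1)
  rw [show (fun ω ↦ (X ω - Y ω) ^ 2) = fun ω ↦ (1 * X ω + -1 * Y ω) ^ 2 by ext; ring, h]
  ring

/-- The reverse triangle inequality in `L²`. -/
lemma sq_sqrt_sub_sqrt_le (hX : MemLp X 2 P) (hY : MemLp Y 2 P) :
    (√(∫ ω, X ω ^ 2 ∂P) - √(∫ ω, Y ω ^ 2 ∂P)) ^ 2 ≤ ∫ ω, (X ω - Y ω) ^ 2 ∂P := by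
  have hx : 0 ≤ ∫ ω, X ω ^ 2 ∂P := integral_nonneg fun ω ↦ sq_nonneg _
  have hy : 0 ≤ ∫ ω, Y ω ^ 2 ∂P := integral_nonneg fun ω ↦ sq_nonneg _
  have h : ∫ ω, X ω * Y ω ∂P ≤ √(∫ ω, X ω ^ 2 ∂P) * √(∫ ω, Y ω ^ 2 ∂P) := by
    rw [← Real.sqrt_mul hx]
    exact Real.le_sqrt_of_sq_le (sq_integral_mul_le hX hY)
  rw [integral_sub_sq hX hY, sub_sq, Real.sq_sqrt hx, Real.sq_sqrt hy]
  linarith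

end SecondMoments

/-! ### Diagonal Gaussian source: the converse. -/

variable {L : ℕ}

/-- The law of independent centred Gaussians with variances `v`. -/
noncomputable def diagGaussian (v : Fin L → ℝ) : Measure (Fin L → ℝ) :=
  Measure.pi fun l ↦ gaussianReal 0 (v l).toNNReal

instance (v : Fin L → ℝ) : IsProbabilityMeasure (diagGaussian v) := by
  unfold diagGaussian; infer_instance

/-- The expected squared Euclidean distance of a pair of real vectors with joint law `π`. -/
noncomputable def coordSqDist (π : Measure ((Fin L → ℝ) × (Fin L → ℝ))) : ℝ≥0∞ :=
  ∑ l, ∫⁻ p, ENNReal.ofReal ((p.1 l - p.2 l) ^ 2) ∂π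

lemma coordSqDist_eq_ofReal {π : Measure ((Fin L → ℝ) × (Fin L → ℝ))}
    (h : ∀ l, Integrable (fun p ↦ (p.1 l - p.2 l) ^ 2) π) :
    coordSqDist π = ENNReal.ofReal (∑ l, ∫ p, (p.1 l - p.2 l) ^ 2 ∂π) := by
  rw [coordSqDist, ENNReal.ofReal_sum_of_nonneg fun l _ ↦ integral_nonneg fun p ↦ sq_nonneg _]
  exact Finset.sum_congr rfl fun l _ ↦
    (ofReal_integral_eq_lintegral_ofReal (h l) (ae_of_all _ fun p ↦ sq_nonneg _)).symm

lemma map_eval_diagGaussian (v : Fin L → ℝ) (l : Fin L) :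
    (diagGaussian v).map (fun x ↦ x l) = gaussianReal 0 (v l).toNNReal :=
  (measurePreserving_eval (fun l ↦ gaussianReal 0 (v l).toNNReal) l).map_eq

section GaussianSource

variable {lam : Fin L → ℝ} {π : Measure ((Fin L → ℝ) × (Fin L → ℝ))}

lemma memLp_fst_of_map_fst (hπ : π.map Prod.fst = diagGaussian lam) (l : Fin L) :
    MemLp (fun p ↦ p.1 l) 2 π := by
  have h : π.map (fun p ↦ p.1 l) = gaussianReal 0 (lam l).toNNReal := by
    rw [← map_eval_diagGaussian, ← hπ, Measure.map_map (by fun_prop) (by fun_prop)]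
    rfl
  have := memLp_id_gaussianReal (μ := 0) (v := (lam l).toNNReal) 2
  rw [← h] at this
  exact this.comp_of_map (by fun_prop)

lemma integral_sq_fst_of_map_fst (hπ : π.map Prod.fst = diagGaussian lam) {l : Fin L}
    (hl : 0 ≤ lam l) : ∫ p, p.1 l ^ 2 ∂π = lam l := by
  have h : π.map (fun p ↦ p.1 l) = gaussianReal 0 (lam l).toNNReal := by
    rw [← map_eval_diagGaussian, ← hπ, Measure.map_map (by fun_prop) (by fun_prop)]
    rfl
  have h2 := integral_sq_gaussianReal (lam l).toNNReal
  rw [← h, integral_map (by fun_prop) (by fun_prop), Real.coe_toNNReal _ hl] at h2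
  exact h2

/-- The perception loss of the second moments bounds the transport cost of every coupling. -/
lemma ofReal_sum_compPerception_le (hlam : ∀ l, 0 < lam l)
    (hπ : π.map Prod.fst = diagGaussian lam) (hY : ∀ l, MemLp (fun p ↦ p.2 l) 2 π) :
    ENNReal.ofReal (∑ l, compPerception (lam l) (∫ p, p.2 l ^ 2 ∂π)) ≤ coordSqDist π := by
  rw [coordSqDist_eq_ofReal fun l ↦ ((memLp_fst_of_map_fst hπ l).sub (hY l)).integrable_sq]
  refine ENNReal.ofReal_le_ofReal (Finset.sum_le_sum fun l _ ↦ ?_)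
  have h := sq_sqrt_sub_sqrt_le (memLp_fst_of_map_fst hπ l) (hY l)
  rwa [integral_sq_fst_of_map_fst hπ (hlam l).le] at h

/-- Mutual information is bounded below by the Gaussian test channel of any linear estimator of
the source whose mean square errors are at most `γ`. -/
lemma ofReal_sum_log_le_mutualInfo [IsProbabilityMeasure π] (hlam : ∀ l, 0 < lam l)
    (hπ : π.map Prod.fst = diagGaussian lam) (hY : ∀ l, MemLp (fun p ↦ p.2 l) 2 π)
    {b γ : Fin L → ℝ} (hγ : ∀ l, 0 < γ l)
    (herr : ∀ l, ∫ p, (p.1 l - b l * p.2 l) ^ 2 ∂π ≤ γ l) :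
    ENNReal.ofReal ((1 / 2 : ℝ) * ∑ l, Real.log (lam l / γ l)) ≤ mutualInfo π := by
  have hX := memLp_fst_of_map_fst hπ
  have i1 : ∀ l, Integrable (fun p : (Fin L → ℝ) × (Fin L → ℝ) ↦
      (p.1 l - b l * p.2 l) ^ 2 / (2 * γ l)) π :=
    fun l ↦ ((hX l).sub ((hY l).const_mul (b l))).integrable_sq.div_const _
  have i2 : ∀ l, Integrable (fun p : (Fin L → ℝ) × (Fin L → ℝ) ↦
      p.1 l ^ 2 / (2 * lam l)) π := fun l ↦ (hX l).integrable_sq.div_const _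
  have i3 : ∀ l, Integrable (fun p : (Fin L → ℝ) × (Fin L → ℝ) ↦
      (1 / 2 : ℝ) * Real.log (lam l / γ l) - (p.1 l - b l * p.2 l) ^ 2 / (2 * γ l)) π :=
    fun l ↦ (integrable_const _).sub (i1 l)
  have i4 : ∀ l, Integrable (fun p : (Fin L → ℝ) × (Fin L → ℝ) ↦
      gaussianLogRatio (lam l) (γ l) (b l * p.2 l) (p.1 l)) π := fun l ↦ (i3 l).add (i2 l)
  have : IsProbabilityMeasure (π.map Prod.fst) := Measure.isProbabilityMeasure_map (by fun_prop)
  have : IsProbabilityMeasure (π.map Prod.snd) := Measure.isProbabilityMeasure_map (by fun_prop)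
  have hdv := ofReal_integral_le_klDiv (π := π) (ρ := (π.map Prod.fst).prod (π.map Prod.snd))
    (f := fun p ↦ ∑ l, gaussianLogRatio (lam l) (γ l) (b l * p.2 l) (p.1 l))
    (hfm := by fun_prop) (integrable_finsetSum _ fun l _ ↦ i4 l) ?_
  · refine le_trans (ENNReal.ofReal_le_ofReal ?_) hdv
    rw [integral_finsetSum _ fun l _ ↦ i4 l, Finset.mul_sum]
    refine Finset.sum_le_sum fun l _ ↦ ?_
    have : ∫ p, gaussianLogRatio (lam l) (γ l) (b l * p.2 l) (p.1 l) ∂π =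
        (1 / 2 : ℝ) * Real.log (lam l / γ l) -
          (∫ p, (p.1 l - b l * p.2 l) ^ 2 ∂π) / (2 * γ l) + 1 / 2 := by
      unfold gaussianLogRatio
      rw [integral_add (i3 l) (i2 l), integral_sub (integrable_const _) (i1 l), integral_div,
        integral_div, integral_sq_fst_of_map_fst hπ (hlam l).le]
      have := (hlam l).ne'
      simp only [integral_const, probReal_univ, smul_eq_mul]
      field_simp
    rw [this]
    -- The error term costs at most the `1 / 2` gained from the variance of the source.
    have h2 : (∫ p, (p.1 l - b l * p.2 l) ^ 2 ∂π) / (2 * γ l) ≤ 1 / 2 := by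
      rw [div_le_iff₀ (by have := hγ l; positivity)]
      linarith [herr l]
    linarith
  · have : IsProbabilityMeasure (π.map Prod.snd) := Measure.isProbabilityMeasure_map (by fun_prop)
    rw [hπ, lintegral_prod_symm _ (by fun_prop)]
    have hone : ∀ y : Fin L → ℝ, ∫⁻ x, ENNReal.ofReal (Real.exp
        (∑ l, gaussianLogRatio (lam l) (γ l) (b l * y l) (x l))) ∂(diagGaussian lam) = 1 := by
      intro y
      simp_rw [Real.exp_sum, ENNReal.ofReal_prod_of_nonneg fun _ _ ↦ (Real.exp_pos _).le]
      rw [diagGaussian, lintegral_pi_prod (g := fun l x ↦ ENNReal.ofReal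
        (Real.exp (gaussianLogRatio (lam l) (γ l) (b l * y l) x))) _ fun l ↦ by fun_prop]
      exact Finset.prod_eq_one fun l _ ↦ lintegral_exp_gaussianLogRatio (hlam l) (hγ l) _
    simp [hone]

/-- If a component of the source is a multiple of the reconstruction component, the mutual
information is infinite. -/
lemma mutualInfo_eq_top [IsProbabilityMeasure π] (hlam : ∀ l, 0 < lam l)
    (hπ : π.map Prod.fst = diagGaussian lam) (hY : ∀ l, MemLp (fun p ↦ p.2 l) 2 π)
    {b : ℝ} (l : Fin L) (herr : ∫ p, (p.1 l - b * p.2 l) ^ 2 ∂π ≤ 0) : mutualInfo π = ∞ := by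
  refine ENNReal.eq_top_of_forall_nnreal_le fun r ↦ ?_
  -- Estimate only component `l`. The others use the zero estimator with `γ = lam` and contribute
  -- nothing, while `lam l * exp (-2r)` makes the bound exactly `r`.
  have h := ofReal_sum_log_le_mutualInfo hlam hπ hY
    (b := Function.update 0 l b) (γ := Function.update lam l (lam l * Real.exp (-(2 * r))))
    (fun j ↦ ?_) (fun j ↦ ?_)
  · refine le_trans ?_ h
    rw [Finset.sum_eq_single l]
    · have := (hlam l).ne'
      rw [Function.update_self, div_mul_cancel_left₀ this, ← Real.exp_neg, neg_neg, Real.log_exp]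
      simp
    · intro j _ hj
      rw [Function.update_of_ne hj, div_self (hlam j).ne', Real.log_one]
    · simp
  · rcases eq_or_ne j l with rfl | hj
    · rw [Function.update_self]
      have := hlam j
      positivity
    · rw [Function.update_of_ne hj]
      exact hlam j
  · rcases eq_or_ne j l with rfl | hj
    · rw [Function.update_self, Function.update_self]
      have := hlam j
      exact herr.trans (by positivity)
    · rw [Function.update_of_ne hj, Function.update_of_ne hj]
      simp [integral_sq_fst_of_map_fst hπ (hlam j).le]

/-- At this error level the square root is `|c|`, which dominates `c`. If `d = 0`, then `hcs` forces
`c = 0`. -/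
lemma compDistortion_le {a c d : ℝ} (hcs : c ^ 2 ≤ a * d) (hd : 0 ≤ d) :
    compDistortion a (a - c ^ 2 / d) d ≤ a - 2 * c + d := by
  have : c ≤ √(d * (a - (a - c ^ 2 / d))) := by
    refine Real.le_sqrt_of_sq_le ?_
    rcases hd.eq_or_lt with rfl | hd
    · simpa using hcs
    · field_simp
      linarith
  rw [compDistortion]
  linarith

/-- Converse in coordinates. -/
lemma iInf_objective_le_mutualInfo [IsProbabilityMeasure π] (hlam : ∀ l, 0 < lam l)
    (hπ : π.map Prod.fst = diagGaussian lam) (hY : ∀ l, MemLp (fun p ↦ p.2 l) 2 π) {D P : ℝ}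
    (hdist : ∑ l, ∫ p, (p.1 l - p.2 l) ^ 2 ∂π ≤ D)
    (hperc : ∑ l, compPerception (lam l) (∫ p, p.2 l ^ 2 ∂π) ≤ P) :
    ⨅ q ∈ feasible lam D P, ENNReal.ofReal (objective lam q) ≤ mutualInfo π := by
  have hX := memLp_fst_of_map_fst hπ
  set d : Fin L → ℝ := fun l ↦ ∫ p, p.2 l ^ 2 ∂π with hd
  set c : Fin L → ℝ := fun l ↦ ∫ p, p.1 l * p.2 l ∂π with hc
  -- Error of the best linear estimator `c / d * Y`. When `d l = 0`, division by zero gives the zero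
  -- estimator and error `lam l`, as it should.
  set γ : Fin L → ℝ := fun l ↦ lam l - c l ^ 2 / d l with hγ
  have hd0 : ∀ l, 0 ≤ d l := fun l ↦ integral_nonneg fun p ↦ sq_nonneg _
  have hcs : ∀ l, c l ^ 2 ≤ lam l * d l := fun l ↦ by
    have := sq_integral_mul_le (hX l) (hY l)
    rwa [integral_sq_fst_of_map_fst hπ (hlam l).le] at this
  have herr : ∀ l, ∫ p, (p.1 l - c l / d l * p.2 l) ^ 2 ∂π = γ l := fun l ↦ by
    rw [integral_sub_sq (hX l) ((hY l).const_mul _), integral_sq_fst_of_map_fst hπ (hlam l).le]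
    simp_rw [mul_pow, mul_left_comm _ (c l / d l)]
    rw [integral_const_mul, integral_const_mul]
    change lam l - 2 * (c l / d l * c l) + (c l / d l) ^ 2 * d l = lam l - c l ^ 2 / d l
    rcases (hd0 l).eq_or_lt with h | h
    · simp [← h]
    · field_simp
      ring
  by_cases hpos : ∀ l, 0 < γ l
  · have hfeas : (γ, d) ∈ feasible lam D P := by
      refine ⟨fun l ↦ ⟨hpos l, ?_⟩, hd0, le_trans (Finset.sum_le_sum fun l _ ↦ ?_) hdist, hperc⟩
      · have := div_nonneg (sq_nonneg (c l)) (hd0 l)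
        simp only [hγ]
        linarith
      · refine (compDistortion_le (hcs l) (hd0 l)).trans_eq ?_
        rw [integral_sub_sq (hX l) (hY l), integral_sq_fst_of_map_fst hπ (hlam l).le]
    exact (iInf₂_le _ hfeas).trans
      (ofReal_sum_log_le_mutualInfo hlam hπ hY hpos fun l ↦ (herr l).le)
  · push Not at hpos
    obtain ⟨l, hl⟩ := hpos
    rw [mutualInfo_eq_top hlam hπ hY l ((herr l).trans_le hl)]
    exact le_top

end GaussianSource

/-! ### Achievability for the diagonal source. -/

/-- The scaling coupling of two diagonal Gaussians. -/
lemma exists_coupling_coordSqDist_eq {lam lamHat : Fin L → ℝ} (hlam : ∀ l, 0 < lam l)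
    (hlh : ∀ l, 0 ≤ lamHat l) :
    ∃ π : Measure ((Fin L → ℝ) × (Fin L → ℝ)), π.map Prod.fst = diagGaussian lam ∧
      π.map Prod.snd = diagGaussian lamHat ∧
      coordSqDist π = ENNReal.ofReal (∑ l, compPerception (lam l) (lamHat l)) := by
  set k : Fin L → ℝ := fun l ↦ √(lamHat l) / √(lam l) with hk
  have hsq : ∀ l, k l ^ 2 * lam l = lamHat l := fun l ↦ by
    have := (hlam l).ne'
    rw [hk, div_pow, Real.sq_sqrt (hlh l), Real.sq_sqrt (hlam l).le]
    field_simp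
  set m : (Fin L → ℝ) → (Fin L → ℝ) × (Fin L → ℝ) := fun z ↦ (z, fun l ↦ k l * z l) with hm
  have hmm : Measurable m := by fun_prop
  have hi : ∀ l, Integrable (fun x : ℝ ↦ (x - k l * x) ^ 2)
      (gaussianReal 0 (lam l).toNNReal) := fun l ↦ by
    have : (fun x : ℝ ↦ (x - k l * x) ^ 2) = fun x ↦ (1 - k l) ^ 2 * x ^ 2 := by ext; ring
    rw [this]
    exact (integrable_sq_gaussianReal _).const_mul _
  refine ⟨(diagGaussian lam).map m, ?_, ?_, ?_⟩
  · rw [Measure.map_map (by fun_prop) hmm]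
    exact Measure.map_id
  · rw [Measure.map_map (by fun_prop) hmm, diagGaussian, diagGaussian]
    have : Prod.snd ∘ m = fun z l ↦ k l * z l := rfl
    have hmap : ∀ l, (gaussianReal 0 (lam l).toNNReal).map (k l * ·) =
        gaussianReal 0 (lamHat l).toNNReal := fun l ↦ by
      rw [gaussianReal_map_const_mul, mul_zero]
      congr 1
      ext
      push_cast
      rw [Real.coe_toNNReal _ (hlam l).le, Real.coe_toNNReal _ (hlh l)]
      exact hsq l
    have hfin : ∀ l, SigmaFinite ((gaussianReal 0 (lam l).toNNReal).map (k l * ·)) :=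
      fun l ↦ by rw [hmap]; infer_instance
    rw [this, Measure.pi_map_pi fun l ↦ by fun_prop]
    simp_rw [hmap]
  · rw [coordSqDist_eq_ofReal]
    · congr 1
      refine Finset.sum_congr rfl fun l _ ↦ ?_
      rw [integral_map hmm.aemeasurable (by fun_prop), diagGaussian]
      simp only [hm]
      rw [integral_comp_eval (μ := fun l ↦ gaussianReal 0 (lam l).toNNReal)
        (f := fun x : ℝ ↦ (x - k l * x) ^ 2) (by fun_prop)]
      have : (fun x : ℝ ↦ (x - k l * x) ^ 2) = fun x ↦ (1 - k l) ^ 2 * x ^ 2 := by ext; ring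
      rw [this, integral_const_mul, integral_sq_gaussianReal, Real.coe_toNNReal _ (hlam l).le,
        compPerception]
      nth_rw 1 [← Real.sq_sqrt (hlam l).le]
      have h2 : √(lam l) ≠ 0 := (Real.sqrt_pos.2 (hlam l)).ne'
      rw [← mul_pow, hk]
      field_simp
    · intro l
      rw [integrable_map_measure (by fun_prop) hmm.aemeasurable]
      exact integrable_comp_eval (μ := fun l ↦ gaussianReal 0 (lam l).toNNReal) (hi l)

/-- The joint law of independent pairs, each distributed according to a backward channel. -/
noncomputable def backwardLawPi (b γ lamHat : Fin L → ℝ) :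
    Measure ((Fin L → ℝ) × (Fin L → ℝ)) :=
  (Measure.pi fun l ↦ backwardLaw (b l) (γ l) (lamHat l)).map
    (MeasurableEquiv.arrowProdEquivProdArrow ℝ ℝ (Fin L))

section BackwardLawPi

variable {b γ lamHat lam : Fin L → ℝ}

instance : IsProbabilityMeasure (backwardLawPi b γ lamHat) :=
  Measure.isProbabilityMeasure_map (MeasurableEquiv.measurable _).aemeasurable

lemma map_snd_backwardLawPi : (backwardLawPi b γ lamHat).map Prod.snd = diagGaussian lamHat := by
  rw [backwardLawPi, Measure.map_map (by fun_prop) (MeasurableEquiv.measurable _)]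
  change (Measure.pi fun l ↦ backwardLaw (b l) (γ l) (lamHat l)).map (fun z l ↦ (z l).2) = _
  have hfin : ∀ l, SigmaFinite ((backwardLaw (b l) (γ l) (lamHat l)).map Prod.snd) :=
    fun l ↦ by rw [map_snd_backwardLaw]; infer_instance
  rw [Measure.pi_map_pi (f := fun _ ↦ Prod.snd) fun l ↦ by fun_prop]
  simp_rw [map_snd_backwardLaw]
  rfl

lemma map_fst_backwardLawPi (hγ : ∀ l, 0 < γ l) (hlh : ∀ l, 0 ≤ lamHat l)
    (h : ∀ l, b l ^ 2 * lamHat l + γ l = lam l) :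
    (backwardLawPi b γ lamHat).map Prod.fst = diagGaussian lam := by
  rw [backwardLawPi, Measure.map_map (by fun_prop) (MeasurableEquiv.measurable _)]
  change (Measure.pi fun l ↦ backwardLaw (b l) (γ l) (lamHat l)).map (fun z l ↦ (z l).1) = _
  have hmap := fun l ↦ map_fst_backwardLaw (hγ l).le (hlh l) (h l)
  have hfin : ∀ l, SigmaFinite ((backwardLaw (b l) (γ l) (lamHat l)).map Prod.fst) :=
    fun l ↦ by rw [hmap]; infer_instance
  rw [Measure.pi_map_pi (f := fun _ ↦ Prod.fst) fun l ↦ by fun_prop]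
  simp_rw [hmap]
  rfl

lemma coordSqDist_backwardLawPi (hγ : ∀ l, 0 < γ l) (hlh : ∀ l, 0 ≤ lamHat l) :
    coordSqDist (backwardLawPi b γ lamHat) =
      ENNReal.ofReal (∑ l, ((b l - 1) ^ 2 * lamHat l + γ l)) := by
  have hmom := fun l ↦ integral_sq_backwardLaw (b := b l) (hγ l).le (hlh l) 1 (-1)
  have he : (fun p : ℝ × ℝ ↦ (1 * p.1 + -1 * p.2) ^ 2) = fun p ↦ (p.1 - p.2) ^ 2 := by ext; ring
  simp_rw [he] at hmom
  rw [coordSqDist_eq_ofReal]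
  · congr 1
    refine Finset.sum_congr rfl fun l _ ↦ ?_
    rw [backwardLawPi, integral_map_equiv]
    refine (integral_comp_eval (μ := fun l ↦ backwardLaw (b l) (γ l) (lamHat l)) (i := l)
        (f := fun p : ℝ × ℝ ↦ (p.1 - p.2) ^ 2) (by fun_prop)).trans ?_
    rw [(hmom l).2]
    ring
  · intro l
    rw [backwardLawPi, integrable_map_equiv]
    exact integrable_comp_eval (μ := fun l ↦ backwardLaw (b l) (γ l) (lamHat l)) (hmom l).1

lemma mutualInfo_backwardLawPi_le (hlam : ∀ l, 0 < lam l) (hγ : ∀ l, 0 < γ l)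
    (hlh : ∀ l, 0 ≤ lamHat l) (h : ∀ l, b l ^ 2 * lamHat l + γ l = lam l) :
    mutualInfo (backwardLawPi b γ lamHat) ≤
      ENNReal.ofReal ((1 / 2 : ℝ) * ∑ l, Real.log (lam l / γ l)) := by
  rw [mutualInfo, map_fst_backwardLawPi hγ hlh h, map_snd_backwardLawPi, backwardLawPi,
    diagGaussian, diagGaussian, ← (measurePreserving_arrowProdEquivProdArrow ℝ ℝ (Fin L)
      (fun l ↦ gaussianReal 0 (lam l).toNNReal) fun l ↦ gaussianReal 0 (lamHat l).toNNReal).map_eq]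
  -- Regroup into one pair per component, so that both laws are products over `l` and the density
  -- factorises.
  refine (InformationTheory.klDiv_map_le _ _ (MeasurableEquiv.measurable _)).trans ?_
  set ρ := Measure.pi fun l ↦
    (gaussianReal 0 (lam l).toNNReal).prod (gaussianReal 0 (lamHat l).toNNReal)
  set f : (Fin L → ℝ × ℝ) → ℝ := fun z ↦
    ∑ l, gaussianLogRatio (lam l) (γ l) (b l * (z l).2) (z l).1 with hf
  have hmom := fun l ↦ integral_gaussianLogRatio_backwardLaw (hlam l) (hγ l) (hlh l) (h l)
  have hint : ∀ l, Integrable (fun z : Fin L → ℝ × ℝ ↦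
      gaussianLogRatio (lam l) (γ l) (b l * (z l).2) (z l).1)
      (Measure.pi fun l ↦ backwardLaw (b l) (γ l) (lamHat l)) :=
    fun l ↦ integrable_comp_eval (μ := fun l ↦ backwardLaw (b l) (γ l) (lamHat l)) (hmom l).1
  have hdens : Measure.pi (fun l ↦ backwardLaw (b l) (γ l) (lamHat l)) =
      ρ.withDensity fun z ↦ ENNReal.ofReal (Real.exp (f z)) := by
    have hl := fun l ↦ backwardLaw_eq_withDensity (b l) (lamHat l) (hlam l) (hγ l)
    have hfin : ∀ l, SigmaFinite (((gaussianReal 0 (lam l).toNNReal).prod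
        (gaussianReal 0 (lamHat l).toNNReal)).withDensity fun p ↦ ENNReal.ofReal
          (Real.exp (gaussianLogRatio (lam l) (γ l) (b l * p.2) p.1))) :=
      fun l ↦ by rw [← hl]; infer_instance
    simp_rw [hl]
    rw [pi_withDensity _ fun l ↦ by fun_prop]
    simp_rw [hf, Real.exp_sum, ENNReal.ofReal_prod_of_nonneg fun _ _ ↦ (Real.exp_pos _).le]
    rfl
  have hfint : Integrable f (Measure.pi fun l ↦ backwardLaw (b l) (γ l) (lamHat l)) :=
    integrable_finsetSum _ fun l _ ↦ hint l
  have hval : ∫ z, f z ∂(Measure.pi fun l ↦ backwardLaw (b l) (γ l) (lamHat l)) =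
      (1 / 2 : ℝ) * ∑ l, Real.log (lam l / γ l) := by
    rw [hf, integral_finsetSum _ fun l _ ↦ hint l, Finset.mul_sum]
    refine Finset.sum_congr rfl fun l _ ↦ ?_
    rw [integral_comp_eval (μ := fun l ↦ backwardLaw (b l) (γ l) (lamHat l)) (i := l)
      (f := fun p : ℝ × ℝ ↦ gaussianLogRatio (lam l) (γ l) (b l * p.2) p.1)
      (hmom l).1.aestronglyMeasurable, (hmom l).2]
  have hprob : IsProbabilityMeasure (ρ.withDensity fun z ↦ ENNReal.ofReal (Real.exp (f z))) := by
    rw [← hdens]; infer_instance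
  rw [← hval, hdens]
  rw [hdens] at hfint
  exact (klDiv_withDensity_ofReal_exp (by fun_prop) hfint).le

end BackwardLawPi

/-- Achievability in coordinates. -/
lemma exists_joint_of_mem_feasible {lam : Fin L → ℝ} (hlam : ∀ l, 0 < lam l) {D P : ℝ}
    {q : (Fin L → ℝ) × (Fin L → ℝ)} (hq : q ∈ feasible lam D P) :
    ∃ π : Measure ((Fin L → ℝ) × (Fin L → ℝ)), IsProbabilityMeasure π ∧
      π.map Prod.fst = diagGaussian lam ∧ π.map Prod.snd = diagGaussian q.2 ∧
      coordSqDist π ≤ ENNReal.ofReal D ∧ mutualInfo π ≤ ENNReal.ofReal (objective lam q) := by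
  obtain ⟨γ, d⟩ := q
  obtain ⟨hγ, hd, hD, -⟩ := hq
  simp only at hγ hd hD
  -- Chosen so that the covariance `b l * d l` is the square root appearing in the distortion
  -- constraint.
  set b : Fin L → ℝ := fun l ↦ √((lam l - γ l) / d l) with hb
  have hb2 : ∀ l, b l ^ 2 = (lam l - γ l) / d l := fun l ↦
    Real.sq_sqrt (div_nonneg (by linarith [hγ l]) (hd l))
  have hbd : ∀ l, b l * d l = √(d l * (lam l - γ l)) := fun l ↦ by
    rcases (hd l).eq_or_lt with h | h
    · simp [← h]
    · have : d l * (lam l - γ l) = (b l * d l) ^ 2 := by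
        rw [mul_pow, hb2]
        field_simp
      rw [this, Real.sqrt_sq (mul_nonneg (Real.sqrt_nonneg _) (hd l))]
  -- This is `γ l` unless `d l = 0`; there `γ l < lam l` is feasible, but the channel must have
  -- noise `lam l`. Raising `γ` only lowers the objective, and the distortion is unaffected.
  set γ' : Fin L → ℝ := fun l ↦ lam l - b l ^ 2 * d l with hγ'
  have hle : ∀ l, γ l ≤ γ' l := fun l ↦ by
    change γ l ≤ lam l - b l ^ 2 * d l
    rw [hb2]
    rcases (hd l).eq_or_lt with h | h
    · simpa [← h] using (hγ l).2
    · field_simp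
      linarith
  have hpos : ∀ l, 0 < γ' l := fun l ↦ (hγ l).1.trans_le (hle l)
  have hvar : ∀ l, b l ^ 2 * d l + γ' l = lam l := fun l ↦ by rw [hγ']; ring
  refine ⟨backwardLawPi b γ' d, inferInstance, map_fst_backwardLawPi hpos hd hvar,
    map_snd_backwardLawPi, ?_, (mutualInfo_backwardLawPi_le hlam hpos hd hvar).trans ?_⟩
  · rw [coordSqDist_backwardLawPi hpos hd]
    refine ENNReal.ofReal_le_ofReal (le_trans (Finset.sum_le_sum fun l _ ↦ ?_) hD)
    rw [compDistortion, ← hbd, ← hvar l]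
    linarith
  · refine ENNReal.ofReal_le_ofReal (mul_le_mul_of_nonneg_left
      (Finset.sum_le_sum fun l _ ↦ ?_) (by norm_num))
    exact Real.log_le_log (div_pos (hlam l) (hpos l))
      (div_le_div_of_nonneg_left (hlam l).le (hγ l).1 (hle l))

/-! ### Diagonalisation of the source. -/

/-- The measurable equivalence from coordinates with respect to the rows of an orthogonal matrix
to the vector itself. -/
noncomputable def ofRotatedCoords (Θ : Matrix (Fin L) (Fin L) ℝ)
    (hΘ : Θ ∈ Matrix.orthogonalGroup (Fin L) ℝ) :
    (Fin L → ℝ) ≃ᵐ EuclideanSpace ℝ (Fin L) where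
  toFun z := WithLp.toLp 2 (Θ.transpose.mulVec z)
  invFun x := Θ.mulVec x.ofLp
  left_inv z := by
    simp only [Matrix.mulVec_mulVec]
    rw [show Θ * Θ.transpose = 1 from (Matrix.mem_orthogonalGroup_iff _ _).1 hΘ, Matrix.one_mulVec]
  right_inv x := by
    simp only [Matrix.mulVec_mulVec]
    rw [(Matrix.mem_orthogonalGroup_iff' _ _).1 hΘ, Matrix.one_mulVec]
  measurable_toFun := by
    have : Measurable fun z : Fin L → ℝ ↦ Θ.transpose.mulVec z :=
      (Matrix.mulVecLin Θ.transpose).continuous_of_finiteDimensional.measurable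
    exact (WithLp.measurable_toLp 2 _).comp this
  measurable_invFun := by
    have : Measurable fun z : Fin L → ℝ ↦ Θ.mulVec z :=
      (Matrix.mulVecLin Θ).continuous_of_finiteDimensional.measurable
    exact this.comp (WithLp.measurable_ofLp 2 _)

section

variable {Θ : Matrix (Fin L) (Fin L) ℝ} (hΘ : Θ ∈ Matrix.orthogonalGroup (Fin L) ℝ)

lemma norm_ofRotatedCoords_sub_sq (z w : Fin L → ℝ) :
    ‖ofRotatedCoords Θ hΘ z - ofRotatedCoords Θ hΘ w‖ ^ 2 = ∑ l, (z l - w l) ^ 2 := by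
  change ‖WithLp.toLp 2 (Θ.transpose.mulVec z) - WithLp.toLp 2 (Θ.transpose.mulVec w)‖ ^ 2 = _
  rw [← WithLp.toLp_sub, ← Matrix.mulVec_sub, EuclideanSpace.real_norm_sq_eq]
  have h : Θ.transpose.mulVec (z - w) ⬝ᵥ Θ.transpose.mulVec (z - w) = (z - w) ⬝ᵥ (z - w) := by
    rw [Matrix.dotProduct_mulVec, Matrix.vecMul_transpose, Matrix.mulVec_mulVec,
      (Matrix.mem_orthogonalGroup_iff _ _).1 hΘ, Matrix.one_mulVec]
  simpa [dotProduct, sq] using h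

lemma expSqDist_map_ofRotatedCoords (π : Measure ((Fin L → ℝ) × (Fin L → ℝ))) :
    expSqDist (π.map (Prod.map (ofRotatedCoords Θ hΘ) (ofRotatedCoords Θ hΘ))) =
      coordSqDist π := by
  rw [expSqDist, lintegral_map (by fun_prop) (by fun_prop), coordSqDist,
    ← lintegral_finsetSum _ fun l _ ↦ by fun_prop]
  refine lintegral_congr fun p ↦ ?_
  rw [Prod.map_fst, Prod.map_snd, ← ofReal_norm, ← ENNReal.ofReal_pow (norm_nonneg _),
    norm_ofRotatedCoords_sub_sq, ENNReal.ofReal_sum_of_nonneg fun _ _ ↦ sq_nonneg _]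

/-- Both characteristic functions at `t` are `exp (-½ ∑ lam l * (Θ t) l ^ 2)`. -/
lemma multivariateGaussian_eq_map_ofRotatedCoords {S : Matrix (Fin L) (Fin L) ℝ}
    {lam : Fin L → ℝ} (hS : S.PosDef) (hlam : ∀ l, 0 < lam l)
    (hdecomp : S = Θ.transpose * Matrix.diagonal lam * Θ) :
    multivariateGaussian 0 S = (diagGaussian lam).map (ofRotatedCoords Θ hΘ) := by
  have : IsProbabilityMeasure ((diagGaussian lam).map (ofRotatedCoords Θ hΘ)) :=
    Measure.isProbabilityMeasure_map (MeasurableEquiv.measurable _).aemeasurable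
  apply Measure.ext_of_charFun
  ext t
  have hinner : ∀ z : Fin L → ℝ, inner ℝ (ofRotatedCoords Θ hΘ z) t =
      inner ℝ (WithLp.toLp 2 z) (WithLp.toLp 2 (Θ.mulVec t.ofLp)) := by
    intro z
    change inner ℝ (WithLp.toLp 2 (Θ.transpose.mulVec z)) t = _
    rw [EuclideanSpace.inner_eq_star_dotProduct, EuclideanSpace.inner_eq_star_dotProduct]
    simp [Matrix.dotProduct_mulVec, Matrix.vecMul_transpose]
  have hchar : charFun ((diagGaussian lam).map (ofRotatedCoords Θ hΘ)) t =
      charFun ((diagGaussian lam).map (WithLp.toLp 2)) (WithLp.toLp 2 (Θ.mulVec t.ofLp)) := by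
    rw [charFun_apply, charFun_apply, integral_map_equiv, integral_map (by fun_prop) (by fun_prop)]
    simp_rw [hinner]
  have hquad : t.ofLp ⬝ᵥ S.mulVec t.ofLp = ∑ l, lam l * Θ.mulVec t.ofLp l ^ 2 := by
    rw [hdecomp, ← Matrix.mulVec_mulVec, ← Matrix.mulVec_mulVec, Matrix.dotProduct_mulVec,
      Matrix.vecMul_transpose, dotProduct]
    refine Finset.sum_congr rfl fun l _ ↦ ?_
    rw [Matrix.mulVec_diagonal]
    ring
  rw [hchar, diagGaussian, charFun_pi, charFun_multivariateGaussian hS.posSemidef, hquad]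
  simp_rw [charFun_gaussianReal, ← Complex.exp_sum, Real.coe_toNNReal _ (hlam _).le]
  congr 1
  push_cast
  simp [Finset.sum_div, Finset.sum_neg_distrib]

end

lemma pos_of_posDef_of_decomp {S Θ : Matrix (Fin L) (Fin L) ℝ} {lam : Fin L → ℝ} (hS : S.PosDef)
    (hΘ : Θ ∈ Matrix.orthogonalGroup (Fin L) ℝ)
    (hdecomp : S = Θ.transpose * Matrix.diagonal lam * Θ) (l : Fin L) : 0 < lam l := by
  have h1 : Θ * Θ.transpose = 1 := (Matrix.mem_orthogonalGroup_iff _ _).1 hΘ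
  have hdiag : Matrix.diagonal lam = Θ * S * Θ.transpose := by
    rw [hdecomp]
    calc Matrix.diagonal lam = (Θ * Θ.transpose) * Matrix.diagonal lam * (Θ * Θ.transpose) := by
          rw [h1]; simp
      _ = _ := by simp only [Matrix.mul_assoc]
  have hinj : Function.Injective (Θ.vecMul) := by
    refine Function.LeftInverse.injective (g := Θ.transpose.vecMul) fun v ↦ ?_
    change Matrix.vecMul (Matrix.vecMul v Θ) Θ.transpose = v
    rw [Matrix.vecMul_vecMul, h1, Matrix.vecMul_one]
  have hpd : (Matrix.diagonal lam).PosDef := by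
    rw [hdiag]
    exact hS.mul_mul_conjTranspose_same hinj
  exact Matrix.posDef_diagonal_iff.1 hpd l

/-! ### Attainment of the minimum -/

section Program

variable {lam : Fin L → ℝ} {D P : ℝ}

/-- Take `lamHat = lam` and `γ = t * lam`: the perception loss is zero, and the distortion tends to
zero as `t` decreases to zero. -/
lemma feasible_nonempty (hlam : ∀ l, 0 < lam l) (hD : 0 < D) (hP : 0 ≤ P) :
    (feasible lam D P).Nonempty := by
  have hcont : ContinuousAt
      (fun t : ℝ ↦ ∑ l, compDistortion (lam l) (t * lam l) (lam l)) 0 := by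
    unfold compDistortion
    fun_prop
  have hzero : ∑ l, compDistortion (lam l) (0 * lam l) (lam l) = 0 := by
    refine Finset.sum_eq_zero fun l _ ↦ ?_
    rw [compDistortion, zero_mul, sub_zero, Real.sqrt_mul_self (hlam l).le]
    ring
  have hev : ∀ᶠ t in nhds (0 : ℝ), ∑ l, compDistortion (lam l) (t * lam l) (lam l) < D :=
    hcont.eventually_lt continuousAt_const (by simpa only [hzero] using hD)
  obtain ⟨t, ⟨ht, ht1⟩, ht0⟩ := (((hev.and (gt_mem_nhds one_pos)).filter_mono
    nhdsWithin_le_nhds).and (self_mem_nhdsWithin (s := Set.Ioi (0 : ℝ)))).exists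
  refine ⟨(fun l ↦ t * lam l, lam), fun l ↦ ⟨mul_pos ht0 (hlam l), ?_⟩, fun l ↦ (hlam l).le,
    ht.le, ?_⟩
  · have := hlam l
    change t * lam l ≤ lam l
    nlinarith
  · simpa [compPerception] using hP

/-- The constraint `0 < γ` is not closed, but an objective at most `C` forces each nonnegative
logarithm to be at most `2C`, keeping `γ` away from zero. The perception constraint bounds `lamHat`.
-/
lemma exists_isMinOn_objective (hlam : ∀ l, 0 < lam l) (hD : 0 < D) (hP : 0 ≤ P) :
    ∃ q ∈ feasible lam D P, IsMinOn (objective lam) (feasible lam D P) q := by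
  obtain ⟨q₀, hq₀⟩ := feasible_nonempty hlam hD hP
  set C := objective lam q₀ with hC
  set lo : Fin L → ℝ := fun l ↦ lam l * Real.exp (-(2 * C)) with hlo
  have hlo0 : ∀ l, 0 < lo l := fun l ↦ mul_pos (hlam l) (Real.exp_pos _)
  set hi : Fin L → ℝ := fun l ↦ (√(lam l) + √P) ^ 2 with hhi
  set box : Set ((Fin L → ℝ) × (Fin L → ℝ)) := Set.Icc lo lam ×ˢ Set.Icc 0 hi with hbox
  set K := box ∩ {q | ∑ l, compDistortion (lam l) (q.1 l) (q.2 l) ≤ D ∧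
    ∑ l, compPerception (lam l) (q.2 l) ≤ P} with hK
  have hKc : IsCompact K := by
    refine (isCompact_Icc.prod isCompact_Icc).inter_right (IsClosed.and ?_ ?_)
    · refine isClosed_le ?_ continuous_const
      unfold compDistortion
      fun_prop
    · refine isClosed_le ?_ continuous_const
      unfold compPerception
      fun_prop
  have hKf : K ⊆ feasible lam D P := by
    rintro q ⟨⟨⟨h1, h2⟩, h3, -⟩, h4, h5⟩
    exact ⟨fun l ↦ ⟨(hlo0 l).trans_le (h1 l), h2 l⟩, h3, h4, h5⟩
  have hsub : ∀ q ∈ feasible lam D P, objective lam q ≤ C → q ∈ K := by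
    rintro q ⟨h1, h2, h3, h4⟩ hle
    have hlog : ∀ l, 0 ≤ Real.log (lam l / q.1 l) := fun l ↦
      Real.log_nonneg ((one_le_div (h1 l).1).2 (h1 l).2)
    refine ⟨⟨⟨fun l ↦ ?_, fun l ↦ (h1 l).2⟩, h2, fun l ↦ ?_⟩, h3, h4⟩
    · have h5 : Real.log (lam l / q.1 l) ≤ 2 * C := by
        have := Finset.single_le_sum (fun l _ ↦ hlog l) (Finset.mem_univ l)
        rw [objective] at hle
        linarith
      rw [Real.log_le_iff_le_exp (div_pos (hlam l) (h1 l).1), div_le_iff₀ (h1 l).1] at h5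
      change lam l * Real.exp (-(2 * C)) ≤ q.1 l
      rw [Real.exp_neg, ← div_eq_mul_inv, div_le_iff₀ (Real.exp_pos _)]
      linarith
    · have h5 : (√(lam l) - √(q.2 l)) ^ 2 ≤ P :=
        (Finset.single_le_sum (f := fun l ↦ compPerception (lam l) (q.2 l))
          (fun l _ ↦ sq_nonneg _) (Finset.mem_univ l)).trans h4
      have h6 := abs_le.1 (Real.abs_le_sqrt h5)
      change q.2 l ≤ (√(lam l) + √P) ^ 2
      rw [← Real.sqrt_le_left (by positivity)]
      linarith [h6.1]
  have hcont : ContinuousOn (objective lam) K := by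
    unfold objective
    refine continuousOn_const.mul (continuousOn_finsetSum _ fun l _ ↦ ContinuousOn.log ?_ ?_)
    · exact continuousOn_const.div (by fun_prop) fun q hq ↦ ((hKf hq).1 l).1.ne'
    · exact fun q hq ↦ (div_pos (hlam l) ((hKf hq).1 l).1).ne'
  obtain ⟨q, hqK, hq⟩ := hKc.exists_isMinOn ⟨q₀, hsub q₀ hq₀ le_rfl⟩ hcont
  refine ⟨q, hKf hqK, fun r hr ↦ ?_⟩
  rcases le_total (objective lam r) C with h | h
  · exact hq (hsub r hr h)
  · exact (hq (hsub q₀ hq₀ le_rfl)).trans h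

end Program

lemma memLp_two_of_lintegral_sq_ne_top {Ω : Type*} [MeasurableSpace Ω] {P : Measure Ω} {X : Ω → ℝ}
    (hX : AEStronglyMeasurable X P) (h : ∫⁻ ω, ENNReal.ofReal (X ω ^ 2) ∂P ≠ ∞) : MemLp X 2 P := by
  rw [memLp_two_iff_integrable_sq hX]
  refine ⟨hX.pow 2, ?_⟩
  rw [hasFiniteIntegral_iff_ofReal (ae_of_all _ fun _ ↦ sq_nonneg _)]
  exact h.lt_top

/-! ### Transfer to the original source. -/

section Rotation

variable {Θ : Matrix (Fin L) (Fin L) ℝ} (hΘ : Θ ∈ Matrix.orthogonalGroup (Fin L) ℝ)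

lemma coordSqDist_map_symm
    (π : Measure (EuclideanSpace ℝ (Fin L) × EuclideanSpace ℝ (Fin L))) :
    coordSqDist (π.map (Prod.map (ofRotatedCoords Θ hΘ).symm (ofRotatedCoords Θ hΘ).symm)) =
      expSqDist π := by
  rw [← expSqDist_map_ofRotatedCoords hΘ, Measure.map_map (by fun_prop) (by fun_prop),
    Prod.map_comp_map]
  simp

variable {lam : Fin L → ℝ}

lemma rate_le_iInf_objective (hlam : ∀ l, 0 < lam l) (D P : ℝ) :
    rate wassersteinTwoSq ((diagGaussian lam).map (ofRotatedCoords Θ hΘ)) D P ≤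
      ⨅ q ∈ feasible lam D P, ENNReal.ofReal (objective lam q) := by
  set U := ofRotatedCoords Θ hΘ
  refine le_iInf₂ fun q hq ↦ ?_
  obtain ⟨π, hprob, hfst, hsnd, hdist, hinfo⟩ := exists_joint_of_mem_feasible hlam hq
  obtain ⟨π', hfst', hsnd', hdist'⟩ := exists_coupling_coordSqDist_eq hlam hq.2.1
  have hEprob : IsProbabilityMeasure (π.map (Prod.map U U)) :=
    Measure.isProbabilityMeasure_map (by fun_prop)
  -- Disintegration converts the backward description into a forward kernel from the source.
  have hcomp : ((diagGaussian lam).map U).compProd (π.map (Prod.map U U)).condKernel =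
      π.map (Prod.map U U) := by
    rw [← hfst, ← map_prodMap_fst π U.measurable U.measurable]
    exact Measure.disintegrate _ _
  refine (iInf₂_le (π.map (Prod.map U U)).condKernel ⟨inferInstance, ?_, ?_⟩).trans
    (by rw [hcomp]; exact (mutualInfo_map_prodMap_le π U.measurable U.measurable).trans hinfo)
  · rw [hcomp, expSqDist_map_ofRotatedCoords]
    exact hdist
  · rw [hcomp, map_prodMap_snd π U.measurable U.measurable, hsnd]
    refine (iInf₂_le (π'.map (Prod.map U U)) ⟨?_, ?_⟩).trans (by
      rw [expSqDist_map_ofRotatedCoords, hdist']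
      exact ENNReal.ofReal_le_ofReal hq.2.2.2)
    · rw [map_prodMap_fst _ U.measurable U.measurable, hfst']
    · rw [map_prodMap_snd _ U.measurable U.measurable, hsnd']

lemma iInf_objective_le_rate (hlam : ∀ l, 0 < lam l) {D P : ℝ} (hD : 0 ≤ D) (hP : 0 ≤ P) :
    ⨅ q ∈ feasible lam D P, ENNReal.ofReal (objective lam q) ≤
      rate wassersteinTwoSq ((diagGaussian lam).map (ofRotatedCoords Θ hΘ)) D P := by
  set U := ofRotatedCoords Θ hΘ
  refine le_iInf₂ fun κ ⟨hκ, hdist, hperc⟩ ↦ ?_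
  set μ := (diagGaussian lam).map U with hμ
  have hμprob : IsProbabilityMeasure μ := Measure.isProbabilityMeasure_map (by fun_prop)
  set π := (μ.compProd κ).map (Prod.map U.symm U.symm) with hπ
  have hπprob : IsProbabilityMeasure π := Measure.isProbabilityMeasure_map (by fun_prop)
  have hμV : μ.map U.symm = diagGaussian lam := by
    rw [hμ, Measure.map_map (by fun_prop) (by fun_prop)]
    simp
  have hfst : π.map Prod.fst = diagGaussian lam := by
    rw [hπ, map_prodMap_fst _ U.symm.measurable U.symm.measurable]
    change ((μ.compProd κ).fst).map U.symm = _
    rw [Measure.fst_compProd, hμV]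
  have hd : coordSqDist π ≤ ENNReal.ofReal D := by rwa [hπ, coordSqDist_map_symm]
  have hX := memLp_fst_of_map_fst hfst
  have hXY : ∀ l, MemLp (fun p ↦ p.1 l - p.2 l) 2 π := fun l ↦ by
    refine memLp_two_of_lintegral_sq_ne_top (by fun_prop) (ne_top_of_le_ne_top ENNReal.ofReal_ne_top
      (le_trans ?_ hd))
    exact Finset.single_le_sum
      (f := fun l ↦ ∫⁻ p, ENNReal.ofReal ((p.1 l - p.2 l) ^ 2) ∂π)
      (fun _ _ ↦ zero_le) (Finset.mem_univ l)
  -- Finite distortion makes `X - Y` square integrable, and hence `Y = X - (X - Y)`.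
  have hY : ∀ l, MemLp (fun p ↦ p.2 l) 2 π := fun l ↦ by
    refine ((hX l).sub (hXY l)).ae_eq (ae_of_all _ fun p ↦ ?_)
    simp
  refine (iInf_objective_le_mutualInfo hlam hfst hY ?_ ?_).trans
    (mutualInfo_map_prodMap_le _ U.symm.measurable U.symm.measurable)
  · rwa [coordSqDist_eq_ofReal fun l ↦ (hXY l).integrable_sq, ENNReal.ofReal_le_ofReal_iff hD]
      at hd
  · rw [← ENNReal.ofReal_le_ofReal_iff hP]
    -- The bound is proved for every coupling `σ`, so no optimal one is needed: its second marginal,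
    -- and so its second moments, agree with those of the reconstruction.
    refine le_trans (le_iInf₂ fun σ ⟨hσ1, hσ2⟩ ↦ ?_) hperc
    have hfst' : (σ.map (Prod.map U.symm U.symm)).map Prod.fst = diagGaussian lam := by
      rw [map_prodMap_fst _ U.symm.measurable U.symm.measurable, hσ1, hμV]
    have hsnd' : (σ.map (Prod.map U.symm U.symm)).map Prod.snd = π.map Prod.snd := by
      rw [hπ, map_prodMap_snd _ U.symm.measurable U.symm.measurable, hσ2,
        map_prodMap_snd _ U.symm.measurable U.symm.measurable]
    rw [← coordSqDist_map_symm hΘ]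
    set σ' := σ.map (Prod.map U.symm U.symm)
    have hY' : ∀ l, MemLp (fun p ↦ p.2 l) 2 σ' := fun l ↦ by
      have h : MemLp (fun y : Fin L → ℝ ↦ y l) 2 (π.map Prod.snd) :=
        (memLp_map_measure_iff (Measurable.aestronglyMeasurable (by fun_prop))
          (by fun_prop)).2 (hY l)
      rw [← hsnd'] at h
      exact h.comp_of_map (by fun_prop)
    have hmom : ∀ l, ∫ p, p.2 l ^ 2 ∂π = ∫ p, p.2 l ^ 2 ∂σ' := fun l ↦ by
      rw [← integral_map (φ := Prod.snd) (f := fun y : Fin L → ℝ ↦ y l ^ 2) (by fun_prop)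
        (Measurable.aestronglyMeasurable (by fun_prop)), ← hsnd', integral_map (by fun_prop)
        (Measurable.aestronglyMeasurable (by fun_prop))]
    simp_rw [hmom]
    exact ofReal_sum_compPerception_le hlam hfst' hY'

end Rotation

end RDP

theorem theorem5 {L : ℕ} (S Θ : Matrix (Fin L) (Fin L) ℝ) (lam : Fin L → ℝ)
    (hS : S.PosDef)
    (hΘ : Θ ∈ Matrix.orthogonalGroup (Fin L) ℝ)
    (hdecomp : S = Θ.transpose * Matrix.diagonal lam * Θ)
    (D P : ℝ) (hD : 0 ≤ D) (hP : 0 ≤ P) :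
    RDP.rate RDP.wassersteinTwoSq (ProbabilityTheory.multivariateGaussian 0 S) D P =
        ⨅ q ∈ RDP.feasible lam D P, ENNReal.ofReal (RDP.objective lam q) ∧
      (0 < D → ∃ q ∈ RDP.feasible lam D P,
        IsMinOn (RDP.objective lam) (RDP.feasible lam D P) q ∧
        RDP.rate RDP.wassersteinTwoSq (ProbabilityTheory.multivariateGaussian 0 S) D P =
          ENNReal.ofReal (RDP.objective lam q)) := by
  have hlam := RDP.pos_of_posDef_of_decomp hS hΘ hdecomp
  have hrate : RDP.rate RDP.wassersteinTwoSq (ProbabilityTheory.multivariateGaussian 0 S) D P =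
      ⨅ q ∈ RDP.feasible lam D P, ENNReal.ofReal (RDP.objective lam q) := by
    rw [RDP.multivariateGaussian_eq_map_ofRotatedCoords hΘ hS hlam hdecomp]
    exact le_antisymm (RDP.rate_le_iInf_objective hΘ hlam D P)
      (RDP.iInf_objective_le_rate hΘ hlam hD hP)
  refine ⟨hrate, fun hDpos ↦ ?_⟩
  obtain ⟨q, hq, hmin⟩ := RDP.exists_isMinOn_objective hlam hDpos hP
  refine ⟨q, hq, hmin, hrate.trans (le_antisymm (iInf₂_le q hq) ?_)⟩
  exact le_iInf₂ fun r hr ↦ ENNReal.ofReal_le_ofReal (hmin hr)
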